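/- All graphs are finite and simple. For integers $\ell,m\ge 1$ let $R(\ell,m)$ be the Ramsey number, that is, the least $n$ such that every graph on $n$ vertices contains a clique $K_\ell$ or an independent set of size $m$. For $t\ge 2$ let $Q(t,n)$ be the minimum independence number of a $K_t$-free graph on $n$ vertices. For a graph $H$ and a function $f$, let $\mathrm{RT}(n,H,f(n))$ be the maximum number of edges of an $H$-free graph on $n$ vertices with independence number (strictly) less than $f(n)$, taken to be $0$ if there is no such graph. We write $\mathrm{RT}(H,f)=c$ if $$\limsup_{n\to\infty}\frac{\mathrm{RT}(n,H,f(n))}{n^2}=\liminf_{n\to\infty}\frac{\mathrm{RT}(n,H,f(n))}{n^2}=c .$$ **Theorem.** Let $s\ge t\ge 2$ be integers and let $r=\left\lfloor\frac{s-1}{t-1}\right\rfloor$. Suppose that there are $\vartheta>0$ and $N>0$ such that $$R(t-1,n)\le \frac{R(t,n)}{n^{\vartheta}}\qquad\text{for all integers } n>N .$$ Then, for the function $f(n)=Q(t,n)$, the Ramsey-Turán density $\mathrm{RT}(K_s,f)$ exists and $$\mathrm{RT}\bigl(K_s,Q(t,n)\bigr)=\frac12\left(1-\frac1r\right).$$ 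-/

import Mathlib

open Filter

noncomputable section

namespace RamseyTuran

/-- The Ramsey number `R(ℓ, m)`: the least `n` such that every graph on `n` vertices contains
a clique on `ℓ` vertices or an independent set of size `m`. -/
def ramseyNumber (ℓ m : ℕ) : ℕ :=
  sInf {n : ℕ | ∀ G : SimpleGraph (Fin n),
    ¬ G.CliqueFree ℓ ∨ ∃ S : Finset (Fin n), G.IsNIndepSet m S}

/-- The inverse Ramsey function `Q(t, n)`: the minimum independence number of the `K_t`-free
graphs on `n` vertices. -/
def inverseRamsey (t n : ℕ) : ℕ :=
  sInf {a : ℕ | ∃ G : SimpleGraph (Fin n), G.CliqueFree t ∧ G.indepNum = a}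

/-- The Ramsey-Turán function `RT(n, H, x)`: the maximum number of edges of an `H`-free graph on
`n` vertices with independence number less than `x` (the value is `0` if there is no such
graph). -/
def rtNumber {V : Type*} (n : ℕ) (H : SimpleGraph V) (x : ℝ) : ℕ :=
  sSup {e : ℕ | ∃ G : SimpleGraph (Fin n),
    H.Free G ∧ (G.indepNum : ℝ) < x ∧ G.edgeSet.ncard = e}

/-- The upper Ramsey-Turán density of `H` with respect to `f`. -/
def upperRTDensity {V : Type*} (H : SimpleGraph V) (f : ℕ → ℝ) : ℝ :=
  limsup (fun n : ℕ => (rtNumber n H (f n) : ℝ) / (n : ℝ) ^ 2) atTop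

/-- The lower Ramsey-Turán density of `H` with respect to `f`. -/
def lowerRTDensity {V : Type*} (H : SimpleGraph V) (f : ℕ → ℝ) : ℝ :=
  liminf (fun n : ℕ => (rtNumber n H (f n) : ℝ) / (n : ℝ) ^ 2) atTop

/-- `RT(H, f)` exists and equals `c`: the upper and the lower density both equal `c`. -/
def HasRTDensity {V : Type*} (H : SimpleGraph V) (f : ℕ → ℝ) (c : ℝ) : Prop :=
  upperRTDensity H f = c ∧ lowerRTDensity H f = c

/-- The polynomial gap between consecutive Ramsey numbers, for a fixed `ℓ`: for some `ϑ > 0`,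
`R(ℓ - 1, n) ≤ R(ℓ, n) / n ^ ϑ` for all sufficiently large `n`. -/
def RamseyGap (ℓ : ℕ) : Prop :=
  ∃ ϑ : ℝ, 0 < ϑ ∧ ∃ N : ℕ, ∀ n : ℕ, N < n →
    (ramseyNumber (ℓ - 1) n : ℝ) ≤ (ramseyNumber ℓ n : ℝ) / (n : ℝ) ^ ϑ

end RamseyTuran

end

/-!
Lower bound. The recursion `R(t, a + 1) ≤ R(t, a) + R(t - 1, a + 1)` and the gap hypothesis show
that `Q(t, n / r + 1) < Q(t, n)` for large `n` if `r ≥ 2`. So the complete join of `r` copies of a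
`K_t`-free graph on about `n / r` vertices with the smallest possible independence number has
independence number less than `Q(t, n)`; it is `K_s`-free because `r (t - 1) < s`.

Upper bound. By supersaturation, a graph with `(1/2 (1 - 1/r) + ε) n²` edges has at least
`c n ^ (r + 1)` ordered `(r + 1)`-cliques. If its independence number is less than `Q(t, n)`, the
gap hypothesis yields `δ > 0` such that every set of `n ^ (1 - δ)` vertices contains a `K_{t-1}`.
Dependent random choice finds such a set all of whose `(t - 1)`-subsets are completely joined to a
proportion `n ^ (-γ)` of all `r`-tuples, each an ordered clique. Choosing a `K_{t-1}` in it and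
passing to the tuples in its common neighbourhood, we repeat this for `r + 1` rounds; the cliques
found are pairwise completely joined and form a `K_{(r+1)(t-1)}`, which contains a `K_s`.
-/

namespace RamseyTuran

open Finset SimpleGraph

/-! ### Ramsey numbers -/

/-- The arrow relation `n → (ℓ, m)` of Ramsey theory: every graph on `n` vertices contains a clique
on `ℓ` vertices or an independent set of size `m`. The Ramsey number `R(ℓ, m)` is the least `n`
for which it holds. -/
def IsRamsey (ℓ m n : ℕ) : Prop :=
  ∀ G : SimpleGraph (Fin n), ¬ G.CliqueFree ℓ ∨ ∃ S : Finset (Fin n), G.IsNIndepSet m S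

lemma isNIndepSet_map_of_comap {V W : Type*} {G : SimpleGraph W} {f : V ↪ W} {m : ℕ}
    {S : Finset V} (hS : (G.comap f).IsNIndepSet m S) : G.IsNIndepSet m (S.map f) := by
  refine ⟨?_, by rw [card_map, hS.card_eq]⟩
  rw [IsIndepSet, coe_map, f.injective.injOn.pairwise_image]
  exact hS.isIndepSet

lemma IsRamsey.exists_subset {ℓ m n : ℕ} (h : IsRamsey ℓ m n) {V : Type*} (G : SimpleGraph V)
    {W : Finset V} (hW : n ≤ #W) :
    (∃ S ⊆ W, G.IsNClique ℓ S) ∨ ∃ S ⊆ W, G.IsNIndepSet m S := by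
  obtain ⟨W', hW'W, hcard⟩ := exists_subset_card_eq hW
  let f : Fin n ↪ V :=
    (W'.equivFinOfCardEq hcard).symm.toEmbedding.trans (Function.Embedding.subtype _)
  have map_subset (S : Finset (Fin n)) : S.map f ⊆ W := by
    intro x hx
    obtain ⟨i, -, rfl⟩ := mem_map.1 hx
    exact hW'W ((W'.equivFinOfCardEq hcard).symm i).2
  rcases h (G.comap f) with hclique | ⟨S, hS⟩
  · simp only [CliqueFree, not_forall, not_not] at hclique
    obtain ⟨S, hS⟩ := hclique
    exact Or.inl ⟨S.map f, map_subset S, hS.map.mono (map_comap_le f G)⟩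
  · exact Or.inr ⟨S.map f, map_subset S, isNIndepSet_map_of_comap hS⟩

lemma IsRamsey.mono {ℓ m n n' : ℕ} (h : IsRamsey ℓ m n) (hn : n ≤ n') : IsRamsey ℓ m n' := by
  intro G
  rcases h.exists_subset G (W := univ) (by simpa using hn) with ⟨S, -, hS⟩ | ⟨S, -, hS⟩
  · exact Or.inl fun hG => hG S hS
  · exact Or.inr ⟨S, hS⟩

lemma isRamsey_iff_forall_le_indepNum {ℓ m n : ℕ} :
    IsRamsey ℓ m n ↔ ∀ G : SimpleGraph (Fin n), G.CliqueFree ℓ → m ≤ G.indepNum := by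
  refine forall_congr' fun G => ?_
  rw [← imp_iff_not_or]
  refine imp_congr_right fun _ => ⟨?_, fun hm => ?_⟩
  · rintro ⟨S, hS⟩
    exact hS.card_eq ▸ hS.isIndepSet.card_le_indepNum
  · obtain ⟨S, hS⟩ := G.exists_isNIndepSet_indepNum
    obtain ⟨T, hTS, hT⟩ := exists_subset_card_eq (hm.trans hS.card_eq.ge)
    exact ⟨T, hS.isIndepSet.mono (coe_subset.2 hTS), hT⟩

lemma IsRamsey.pos {ℓ m n : ℕ} (h : IsRamsey ℓ m n) (hℓ : 0 < ℓ) (hm : 0 < m) : 0 < n := by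
  rcases h ⊥ with hclique | ⟨S, hS⟩
  · simp only [CliqueFree, not_forall, not_not] at hclique
    obtain ⟨S, hS⟩ := hclique
    exact hℓ.trans_le (hS.card_eq ▸ card_finset_fin_le S)
  · exact hm.trans_le (hS.card_eq ▸ card_finset_fin_le S)

lemma IsRamsey.succ_succ {ℓ m a b : ℕ} (ha : IsRamsey (ℓ + 1) m a) (hb : IsRamsey ℓ (m + 1) b)
    (hab : 0 < a + b) : IsRamsey (ℓ + 1) (m + 1) (a + b) := by
  classical
  intro G
  let v : Fin (a + b) := ⟨0, hab⟩
  have hcard : a + b ≤ Gᶜ.degree v + G.degree v + 1 := by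
    have := G.degree_compl (v := v)
    rw [Fintype.card_fin] at this
    omega
  rcases (by omega : a ≤ Gᶜ.degree v ∨ b ≤ G.degree v) with hA | hB
  · rcases ha.exists_subset G (W := Gᶜ.neighborFinset v) (by simpa using hA) with
      ⟨S, -, hS⟩ | ⟨S, hSA, hS⟩
    · exact Or.inl fun hG => hG S hS
    · refine Or.inr ⟨insert v S, ?_⟩
      rw [← isNClique_compl] at hS ⊢
      exact hS.insert fun w hw => (mem_neighborFinset _ _ _).1 (hSA hw)
  · rcases hb.exists_subset G (W := G.neighborFinset v) (by simpa using hB) with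
      ⟨S, hSB, hS⟩ | ⟨S, -, hS⟩
    · exact Or.inl fun hG =>
        hG (insert v S) (hS.insert fun w hw => (mem_neighborFinset _ _ _).1 (hSB hw))
    · exact Or.inr ⟨S, hS⟩

lemma isRamsey_zero_left (m n : ℕ) : IsRamsey 0 m n :=
  fun _ => Or.inl fun hG => hG ∅ (by simp [isNClique_iff])

lemma isRamsey_zero_right (ℓ n : ℕ) : IsRamsey ℓ 0 n :=
  fun _ => Or.inr ⟨∅, by simp [isNIndepSet_iff]⟩

lemma isRamsey_one_left (m : ℕ) : IsRamsey 1 m 1 :=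
  fun _ => Or.inl fun hG => hG {0} (by simp [isNClique_iff])

lemma isRamsey_pow (ℓ m : ℕ) : IsRamsey (ℓ + 1) m (m ^ ℓ) := by
  induction ℓ generalizing m with
  | zero => exact isRamsey_one_left m
  | succ ℓ ihℓ =>
    induction m with
    | zero => exact isRamsey_zero_right _ _
    | succ m ihm =>
      refine (ihm.succ_succ (ihℓ (m + 1)) (by positivity)).mono ?_
      calc m ^ (ℓ + 1) + (m + 1) ^ ℓ ≤ (m + 1) ^ ℓ * m + (m + 1) ^ ℓ := by
            rw [pow_succ]
            gcongr
            exact m.le_succ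
        _ = (m + 1) ^ (ℓ + 1) := by ring

lemma isRamsey_ramseyNumber (ℓ m : ℕ) : IsRamsey ℓ m (ramseyNumber ℓ m) := by
  refine Nat.sInf_mem (s := {n | IsRamsey ℓ m n}) ?_
  cases ℓ with
  | zero => exact ⟨0, isRamsey_zero_left m 0⟩
  | succ ℓ => exact ⟨_, isRamsey_pow ℓ m⟩

lemma ramseyNumber_le_iff {ℓ m n : ℕ} : ramseyNumber ℓ m ≤ n ↔ IsRamsey ℓ m n :=
  ⟨(isRamsey_ramseyNumber ℓ m).mono, fun h => Nat.sInf_le h⟩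

lemma ramseyNumber_succ_succ_le {ℓ : ℕ} (hℓ : 0 < ℓ) (m : ℕ) :
    ramseyNumber (ℓ + 1) (m + 1) ≤ ramseyNumber (ℓ + 1) m + ramseyNumber ℓ (m + 1) :=
  have hpos := (isRamsey_ramseyNumber ℓ (m + 1)).pos hℓ m.succ_pos
  ramseyNumber_le_iff.2 <| (isRamsey_ramseyNumber (ℓ + 1) m).succ_succ
    (isRamsey_ramseyNumber ℓ (m + 1)) (Nat.add_pos_right _ hpos)

/-! ### The inverse Ramsey function -/

lemma exists_cliqueFree_indepNum_eq_inverseRamsey {t : ℕ} (ht : 2 ≤ t) (n : ℕ) :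
    ∃ G : SimpleGraph (Fin n), G.CliqueFree t ∧ G.indepNum = inverseRamsey t n :=
  Nat.sInf_mem (s := {a : ℕ | ∃ G : SimpleGraph (Fin n), G.CliqueFree t ∧ G.indepNum = a})
    ⟨_, ⊥, cliqueFree_bot ht, rfl⟩

lemma le_inverseRamsey_iff {t m n : ℕ} (ht : 2 ≤ t) :
    m ≤ inverseRamsey t n ↔ ramseyNumber t m ≤ n := by
  rw [ramseyNumber_le_iff, isRamsey_iff_forall_le_indepNum]
  refine ⟨fun hm G hG => hm.trans (Nat.sInf_le ⟨G, hG, rfl⟩), fun h => ?_⟩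
  obtain ⟨G, hG, hGt⟩ := exists_cliqueFree_indepNum_eq_inverseRamsey ht n
  exact hGt ▸ h G hG

lemma lt_inverseRamsey_add_one_pow {t : ℕ} (ht : 2 ≤ t) (n : ℕ) :
    n < (inverseRamsey t n + 1) ^ (t - 1) := by
  obtain ⟨u, rfl⟩ := Nat.exists_eq_add_of_le' (one_le_two.trans ht)
  by_contra! h
  have hle := (le_inverseRamsey_iff ht).2 (ramseyNumber_le_iff.2 ((isRamsey_pow u _).mono h))
  exact Nat.not_succ_le_self _ hle

lemma eventually_rpow_le_inverseRamsey {t : ℕ} (ht : 2 ≤ t) :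
    ∀ᶠ n : ℕ in atTop, (n : ℝ) ^ (1 / (2 * ((t - 1 : ℕ) : ℝ))) ≤ inverseRamsey t n := by
  have ht0 : (0 : ℝ) < (t - 1 : ℕ) := by exact_mod_cast Nat.sub_pos_of_lt ht
  have hlarge := ((tendsto_rpow_atTop
    (by positivity : 0 < 1 / (2 * ((t - 1 : ℕ) : ℝ)))).comp
      tendsto_natCast_atTop_atTop).eventually_ge_atTop 2
  filter_upwards [hlarge] with n hn
  simp only [Function.comp_apply] at hn
  set z := (n : ℝ) ^ (1 / (2 * ((t - 1 : ℕ) : ℝ))) with hz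
  have hzn : (z ^ 2) ^ (t - 1) = n := by
    rw [← pow_mul, hz, ← Real.rpow_natCast, ← Real.rpow_mul (by positivity)]
    push_cast
    rw [one_div_mul_cancel (by positivity), Real.rpow_one]
  by_contra! hlt
  have hle : ((inverseRamsey t n : ℝ) + 1) ^ (t - 1) ≤ n :=
    calc ((inverseRamsey t n : ℝ) + 1) ^ (t - 1) ≤ (z ^ 2) ^ (t - 1) := by gcongr; nlinarith
      _ = n := hzn
  exact (lt_inverseRamsey_add_one_pow ht n).not_ge (by exact_mod_cast hle)

lemma tendsto_inverseRamsey_atTop {t : ℕ} (ht : 2 ≤ t) :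
    Tendsto (inverseRamsey t) atTop atTop := by
  have ht0 : (0 : ℝ) < (t - 1 : ℕ) := by exact_mod_cast Nat.sub_pos_of_lt ht
  exact tendsto_natCast_atTop_iff.1 (tendsto_atTop_mono' _ (eventually_rpow_le_inverseRamsey ht)
    ((tendsto_rpow_atTop (by positivity)).comp tendsto_natCast_atTop_atTop))

lemma RamseyGap.eventually_exists_isNClique {t : ℕ} (ht : 2 ≤ t) (hgap : RamseyGap t) :
    ∃ δ : ℝ, 0 < δ ∧ δ ≤ 1 ∧ ∀ᶠ n : ℕ in atTop, ∀ G : SimpleGraph (Fin n),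
      G.indepNum < inverseRamsey t n →
      ∀ U : Finset (Fin n), (n : ℝ) ^ (1 - δ) ≤ #U → ∃ S ⊆ U, G.IsNClique (t - 1) S := by
  obtain ⟨ϑ, hϑ, N, hN⟩ := hgap
  have ht0 : (0 : ℝ) < (t - 1 : ℕ) := by exact_mod_cast Nat.sub_pos_of_lt ht
  refine ⟨min 1 (ϑ / (2 * ((t - 1 : ℕ) : ℝ))), by positivity, min_le_left _ _, ?_⟩
  filter_upwards [eventually_rpow_le_inverseRamsey ht, eventually_ge_atTop 1,
    (tendsto_inverseRamsey_atTop ht).eventually_gt_atTop N] with n hq hn hqN G hG U hU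
  have hn0 : (0 : ℝ) < n := by exact_mod_cast hn
  set δ := min 1 (ϑ / (2 * ((t - 1 : ℕ) : ℝ)))
  have hpow : (n : ℝ) ^ δ ≤ (inverseRamsey t n : ℝ) ^ ϑ :=
    calc (n : ℝ) ^ δ ≤ (n : ℝ) ^ (ϑ / (2 * ((t - 1 : ℕ) : ℝ))) :=
          Real.rpow_le_rpow_of_exponent_le (by exact_mod_cast hn) (min_le_right _ _)
      _ = ((n : ℝ) ^ (1 / (2 * ((t - 1 : ℕ) : ℝ)))) ^ ϑ := by
          rw [← Real.rpow_mul hn0.le]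
          congr 1
          ring
      _ ≤ (inverseRamsey t n : ℝ) ^ ϑ := by gcongr
  have hramsey : (ramseyNumber (t - 1) (inverseRamsey t n) : ℝ) ≤ #U :=
    calc (ramseyNumber (t - 1) (inverseRamsey t n) : ℝ)
        ≤ ramseyNumber t (inverseRamsey t n) / (inverseRamsey t n : ℝ) ^ ϑ := hN _ hqN
      _ ≤ n / (n : ℝ) ^ δ := by
          gcongr
          exact (le_inverseRamsey_iff ht).1 le_rfl
      _ = (n : ℝ) ^ (1 - δ) := by rw [Real.rpow_sub hn0, Real.rpow_one]
      _ ≤ #U := hU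
  refine ((isRamsey_ramseyNumber (t - 1) _).exists_subset G
    (by exact_mod_cast hramsey)).resolve_right ?_
  rintro ⟨S, -, hS⟩
  exact hG.not_ge (hS.card_eq ▸ hS.isIndepSet.card_le_indepNum)

lemma RamseyGap.eventually_inverseRamsey_div_add_one_lt {t r : ℕ} (ht : 2 ≤ t) (hr : 2 ≤ r)
    (hgap : RamseyGap t) :
    ∀ᶠ n : ℕ in atTop, inverseRamsey t (n / r + 1) < inverseRamsey t n := by
  obtain ⟨ϑ, hϑ, N, hN⟩ := hgap
  have hdiv : Tendsto (fun n : ℕ => n / r + 1) atTop atTop :=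
    (tendsto_add_atTop_nat 1).comp (Nat.tendsto_div_const_atTop (by omega))
  have hq := (tendsto_add_atTop_nat 1).comp ((tendsto_inverseRamsey_atTop ht).comp hdiv)
  have hq4 := ((tendsto_rpow_atTop hϑ).comp
    (tendsto_natCast_atTop_atTop.comp hq)).eventually_ge_atTop 4
  filter_upwards [hq.eventually_gt_atTop N, hq4, eventually_ge_atTop 4] with n haN ha4 hn
  simp only [Function.comp_apply] at haN ha4
  have hle : ramseyNumber t (inverseRamsey t (n / r + 1)) ≤ n / r + 1 :=
    (le_inverseRamsey_iff ht).1 le_rfl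
  set a := inverseRamsey t (n / r + 1)
  have hrec : ramseyNumber t (a + 1) ≤ ramseyNumber t a + ramseyNumber (t - 1) (a + 1) := by
    simpa only [Nat.sub_add_cancel (one_le_two.trans ht)] using
      ramseyNumber_succ_succ_le (Nat.sub_pos_of_lt ht) a
  have hquarter : 4 * ramseyNumber (t - 1) (a + 1) ≤ ramseyNumber t (a + 1) := by
    have : (ramseyNumber (t - 1) (a + 1) : ℝ) ≤ ramseyNumber t (a + 1) / 4 :=
      (hN _ haN).trans (by gcongr)
    rw [le_div_iff₀' four_pos] at this
    exact_mod_cast this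
  have hhalf : n / r ≤ n / 2 := Nat.div_le_div_left hr two_pos
  refine (le_inverseRamsey_iff ht).2 ?_
  change ramseyNumber t (a + 1) ≤ n
  omega

/-! ### Dependent random choice -/

lemma card_filter_forall_apply {B : Type*} [Fintype B] (Q : B → Prop) [DecidablePred Q] (d : ℕ) :
    #{x : Fin d → B | ∀ i, Q (x i)} = #{b | Q b} ^ d := by
  classical
  have : ({x : Fin d → B | ∀ i, Q (x i)} : Finset (Fin d → B)) =
      Fintype.piFinset fun _ => {b | Q b} := by
    ext x
    simp only [mem_filter, mem_univ, true_and, Fintype.mem_piFinset]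
  rw [this, Fintype.card_piFinset, prod_const, card_univ, Fintype.card_fin]

lemma sum_card_filter_forall_apply {V B : Type*} [Fintype B] (s : Finset V) (P : V → B → Prop)
    [∀ v, DecidablePred (P v)] (d : ℕ) :
    ∑ x : Fin d → B, #{v ∈ s | ∀ i, P v (x i)} = ∑ v ∈ s, #{b | P v b} ^ d := by
  have hcomm := sum_card_bipartiteAbove_eq_sum_card_bipartiteBelow (s := s)
    (t := (univ : Finset (Fin d → B))) fun v x => ∀ i, P v (x i)
  simp only [bipartiteAbove, bipartiteBelow, card_filter_forall_apply] at hcomm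
  exact hcomm.symm

lemma card_mul_pow_le_sum_pow {ι : Type*} {s : Finset ι} {f : ι → ℝ} {a : ℝ}
    (hf : ∀ i ∈ s, 0 ≤ f i) (ha : 0 ≤ a) (h : a * #s ≤ ∑ i ∈ s, f i) (d : ℕ) :
    #s * a ^ d ≤ ∑ i ∈ s, f i ^ d := by
  obtain rfl | hs := s.eq_empty_or_nonempty
  · simp only [card_empty, Nat.cast_zero, zero_mul, sum_empty, le_refl]
  cases d with
  | zero => simp only [pow_zero, mul_one, sum_const, nsmul_eq_mul, le_refl]
  | succ d =>
    have hs0 : (0 : ℝ) < #s := by exact_mod_cast hs.card_pos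
    refine le_of_mul_le_mul_left ?_ (pow_pos hs0 d)
    calc (#s : ℝ) ^ d * (#s * a ^ (d + 1)) = (a * #s) ^ (d + 1) := by ring
      _ ≤ (∑ i ∈ s, f i) ^ (d + 1) := by gcongr
      _ ≤ #s ^ d * ∑ i ∈ s, f i ^ (d + 1) := pow_sum_le_card_mul_sum_pow hf d

lemma exists_subset_forall_not_subset {V : Type*} [DecidableEq V] (X : Finset V)
    {T : Finset (Finset V)} (hT : ∀ S ∈ T, S.Nonempty) :
    ∃ U ⊆ X, #X ≤ #U + #{S ∈ T | S ⊆ X} ∧ ∀ S ∈ T, ¬ S ⊆ U := by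
  choose c hc using fun S : T => hT S S.2
  let D : Finset V := ({S : T | S.1 ⊆ X} : Finset T).image c
  have hD : #D ≤ #{S ∈ T | S ⊆ X} := by
    refine card_image_le.trans (card_le_card_of_injOn Subtype.val ?_ Subtype.val_injective.injOn)
    intro S hS
    exact mem_filter.2 ⟨S.2, (mem_filter.1 hS).2⟩
  refine ⟨X \ D, sdiff_subset, ?_, fun S hS hSU => ?_⟩
  · have := le_card_sdiff D X
    omega
  · refine (Finset.mem_sdiff.1 (hSU (hc ⟨S, hS⟩))).2 (mem_image_of_mem c ?_)
    exact mem_filter.2 ⟨mem_univ _, hSU.trans sdiff_subset⟩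

lemma exists_forall_apply_card_sub_le {V B : Type*} [Fintype V] [DecidableEq V] [Fintype B]
    [Nonempty B] (P : V → B → Prop) [∀ v b, Decidable (P v b)] (d : ℕ) {p β : ℝ} (hp : 0 ≤ p)
    (hP : p * Fintype.card V * Fintype.card B ≤ ∑ v, (#{b | P v b} : ℝ)) {T : Finset (Finset V)}
    (hT : ∀ S ∈ T, (#{b | ∀ v ∈ S, P v b} : ℝ) ≤ β * Fintype.card B) :
    ∃ x : Fin d → B, Fintype.card V * p ^ d - #T * β ^ d ≤
      (#{v | ∀ i, P v (x i)} : ℝ) - #{S ∈ T | S ⊆ ({v | ∀ i, P v (x i)} : Finset V)} := by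
  set n : ℝ := (Fintype.card V : ℝ)
  set N : ℝ := (Fintype.card B : ℝ) with hN
  let X (x : Fin d → B) : Finset V := {v | ∀ i, P v (x i)}
  have hX : n * (p * N) ^ d ≤ ∑ x, (#(X x) : ℝ) := by
    have hsum := sum_card_filter_forall_apply univ P d
    calc n * (p * N) ^ d ≤ ∑ v, (#{b | P v b} : ℝ) ^ d := by
          refine card_mul_pow_le_sum_pow (fun _ _ => by positivity) (by positivity) ?_ d
          rwa [mul_right_comm]
      _ = ∑ x, (#(X x) : ℝ) := by exact_mod_cast hsum.symm
  have hbad : ∑ x, (#{S ∈ T | S ⊆ X x} : ℝ) ≤ #T * (β * N) ^ d := by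
    have hsubset (x : Fin d → B) (S : Finset V) : S ⊆ X x ↔ ∀ i, ∀ v ∈ S, P v (x i) := by
      simp only [X, subset_iff, mem_filter, mem_univ, true_and]
      exact ⟨fun H i v hv => H hv i, fun H v hv i => H i v hv⟩
    have hsum := sum_card_filter_forall_apply T (fun S b => ∀ v ∈ S, P v b) d
    simp_rw [hsubset]
    calc ∑ x : Fin d → B, (#{S ∈ T | ∀ i, ∀ v ∈ S, P v (x i)} : ℝ)
        = ∑ S ∈ T, (#{b | ∀ v ∈ S, P v b} : ℝ) ^ d := by exact_mod_cast hsum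
      _ ≤ #T • (β * N) ^ d := sum_le_card_nsmul _ _ _ fun S hS => by
          gcongr
          exact hT S hS
      _ = #T * (β * N) ^ d := nsmul_eq_mul _ _
  obtain ⟨x, -, hx⟩ := exists_le_of_sum_le (s := univ) (f := fun _ => n * p ^ d - #T * β ^ d)
    (g := fun x => (#(X x) : ℝ) - #{S ∈ T | S ⊆ X x}) univ_nonempty (by
      calc ∑ _ : Fin d → B, (n * p ^ d - #T * β ^ d)
          = n * (p * N) ^ d - #T * (β * N) ^ d := by
            rw [sum_const, card_univ, Fintype.card_fun, Fintype.card_fin, nsmul_eq_mul]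
            push_cast
            ring
        _ ≤ ∑ x, (#(X x) : ℝ) - ∑ x, (#{S ∈ T | S ⊆ X x} : ℝ) := sub_le_sub hX hbad
        _ = ∑ x, ((#(X x) : ℝ) - #{S ∈ T | S ⊆ X x}) := (sum_sub_distrib _ _).symm)
  exact ⟨x, hx⟩

-- Sample `d` elements of `B` uniformly and independently: on average at least `|V| p ^ d` elements
-- of `V` are related to all of them, and these contain on average at most `|V| ^ h β ^ d` of the
-- `h`-sets with few common relatives. Deleting one element from each of the latter leaves `U`.
open Classical in
lemma dependent_random_choice {V B : Type*} [Fintype V] [Fintype B] [Nonempty B]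
    (P : V → B → Prop) {h : ℕ} (hh : 0 < h) (d : ℕ) {p β : ℝ}
    (hp : 0 ≤ p) (hβ : 0 ≤ β)
    (hP : p * Fintype.card V * Fintype.card B ≤ ∑ v, (#{b | P v b} : ℝ)) :
    ∃ U : Finset V, Fintype.card V * p ^ d - (Fintype.card V : ℝ) ^ h * β ^ d ≤ #U ∧
      ∀ S ⊆ U, #S = h → β * Fintype.card B ≤ #{b | ∀ v ∈ S, P v b} := by
  let bad : Finset (Finset V) :=
    {S ∈ powersetCard h univ | (#{b | ∀ v ∈ S, P v b} : ℝ) < β * Fintype.card B}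
  have hcard : #bad ≤ Fintype.card V ^ h :=
    calc #bad ≤ #(powersetCard h (univ : Finset V)) := card_filter_le _ _
      _ = (Fintype.card V).choose h := by rw [card_powersetCard, card_univ]
      _ ≤ Fintype.card V ^ h := Nat.choose_le_pow _ _
  obtain ⟨x, hx⟩ := exists_forall_apply_card_sub_le P d hp hP (T := bad) (β := β)
    fun S hS => (mem_filter.1 hS).2.le
  set X : Finset V := {v | ∀ i, P v (x i)}
  obtain ⟨U, -, hXU, hU⟩ := exists_subset_forall_not_subset X (T := bad) fun S hS =>
    card_pos.1 ((mem_powersetCard.1 (mem_filter.1 hS).1).2 ▸ hh)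
  refine ⟨U, ?_, fun S hSU hSh => ?_⟩
  · calc Fintype.card V * p ^ d - (Fintype.card V : ℝ) ^ h * β ^ d
        ≤ Fintype.card V * p ^ d - #bad * β ^ d := by
          gcongr
          exact_mod_cast hcard
      _ ≤ #X - #{S ∈ bad | S ⊆ X} := hx
      _ ≤ #U := by
          rw [sub_le_iff_le_add]
          exact_mod_cast hXU
  · by_contra hlt
    exact hU S (mem_filter.2 ⟨mem_powersetCard.2 ⟨subset_univ S, hSh⟩, not_le.1 hlt⟩) hSU

/-! ### Cliques from clique tuples -/

open Classical in
/-- The ordered `k`-cliques of `G` inside `W`. Ordered tuples rather than sets are counted so that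
the first vertex can be split off by `Fin.cons`. -/
noncomputable def cliqueTuples {V : Type*} [Fintype V] (G : SimpleGraph V) (k : ℕ) (W : Finset V) :
    Finset (Fin k → V) :=
  {T | (∀ i, T i ∈ W) ∧ ∀ i j, i ≠ j → G.Adj (T i) (T j)}

section CliqueTuples

variable {V : Type*} [Fintype V] (G : SimpleGraph V)

lemma card_cliqueTuples_zero (W : Finset V) : #(cliqueTuples G 0 W) = 1 := by
  simp [cliqueTuples]

variable {G} in
open Classical in
lemma cons_mem_cliqueTuples {k : ℕ} {W : Finset V} {v : V} {T : Fin k → V} :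
    (Fin.cons v T : Fin (k + 1) → V) ∈ cliqueTuples G (k + 1) W ↔
      v ∈ W ∧ T ∈ cliqueTuples G k {w ∈ W | G.Adj v w} := by
  simp only [cliqueTuples, mem_filter, mem_univ, true_and, Fin.forall_fin_succ, Fin.cons_zero,
    Fin.cons_succ, ne_eq, not_true_eq_false, false_imp_iff, Fin.succ_ne_zero, not_false_eq_true,
    true_imp_iff, Fin.succ_inj, (Fin.succ_ne_zero _).symm]
  constructor
  · rintro ⟨⟨hv, hT⟩, hvT, hTT⟩
    exact ⟨hv, fun i => ⟨hT i, hvT i⟩, fun i => (hTT i).2⟩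
  · rintro ⟨hv, hT, hTT⟩
    exact ⟨⟨hv, fun i => (hT i).1⟩, fun i => (hT i).2, fun i => ⟨(hT i).2.symm, hTT i⟩⟩

variable {G} in
open Classical in
lemma forall_cons_mem_cliqueTuples {k : ℕ} {A W : Finset V} (hA : A.Nonempty) {T : Fin k → V} :
    (∀ v ∈ A, (Fin.cons v T : Fin (k + 1) → V) ∈ cliqueTuples G (k + 1) W) ↔
      A ⊆ W ∧ T ∈ cliqueTuples G k {w ∈ W | ∀ v ∈ A, G.Adj v w} := by
  obtain ⟨a, ha⟩ := hA
  simp only [cons_mem_cliqueTuples]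
  simp only [cliqueTuples, mem_filter, mem_univ, true_and]
  constructor
  · intro h
    exact ⟨fun v hv => (h v hv).1,
      fun i => ⟨((h a ha).2.1 i).1, fun v hv => ((h v hv).2.1 i).2⟩, (h a ha).2.2⟩
  · rintro ⟨hAW, hT, hTT⟩ v hv
    exact ⟨hAW hv, fun i => ⟨(hT i).1, (hT i).2 v hv⟩, hTT⟩

open Classical in
lemma card_cliqueTuples_succ_eq_sum_cons (k : ℕ) (W : Finset V) :
    #(cliqueTuples G (k + 1) W) =
      ∑ v, #{T : Fin k → V | (Fin.cons v T : Fin (k + 1) → V) ∈ cliqueTuples G (k + 1) W} := by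
  rw [← card_sigma]
  refine card_bij' (fun T _ => ⟨T 0, Fin.tail T⟩) (fun x _ => Fin.cons x.1 x.2) ?_ ?_ ?_ ?_
  · intro T hT
    simpa only [mem_sigma, mem_univ, mem_filter, true_and, Fin.cons_self_tail] using hT
  · intro x hx
    simpa only [mem_sigma, mem_univ, mem_filter, true_and] using hx
  · intro T _
    exact Fin.cons_self_tail T
  · intro x _
    simp only [Fin.cons_zero, Fin.tail_cons]

open Classical in
lemma card_cliqueTuples_succ (k : ℕ) (W : Finset V) :
    #(cliqueTuples G (k + 1) W) = ∑ v ∈ W, #(cliqueTuples G k {w ∈ W | G.Adj v w}) := by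
  rw [card_cliqueTuples_succ_eq_sum_cons, ← sum_subset (subset_univ W)]
  · refine sum_congr rfl fun v hv => congrArg card ?_
    ext T
    simp only [mem_filter, mem_univ, true_and, cons_mem_cliqueTuples, hv]
  · intro v _ hv
    simp only [cons_mem_cliqueTuples, hv, false_and, filter_false, card_empty]

lemma cliqueTuples_mono (k : ℕ) {W W' : Finset V} (h : W ⊆ W') :
    cliqueTuples G k W ⊆ cliqueTuples G k W' := by
  intro T hT
  simp only [cliqueTuples, mem_filter, mem_univ, true_and] at hT ⊢
  exact ⟨fun i => h (hT.1 i), hT.2⟩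

open Classical in
lemma pow_le_card_cliqueTuples {x y : ℝ} (hx : 0 ≤ x) (hy : 0 ≤ y) (k : ℕ) (W : Finset V)
    (hW : ∀ v ∈ W, (#{w ∈ W | ¬ G.Adj v w} : ℝ) ≤ x) (hxy : k * x + y ≤ #W) :
    y ^ (k + 1) ≤ #(cliqueTuples G (k + 1) W) := by
  induction k generalizing W with
  | zero =>
    simpa only [card_cliqueTuples_succ, card_cliqueTuples_zero, sum_const, smul_eq_mul, mul_one,
      zero_add, pow_one, Nat.cast_zero, zero_mul] using hxy
  | succ k ih =>
    have hyW : y ≤ #W := (le_add_of_nonneg_left (by positivity)).trans hxy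
    have hextend : ∀ v ∈ W, y ^ (k + 1) ≤ #(cliqueTuples G (k + 1) {w ∈ W | G.Adj v w}) := by
      intro v hv
      refine ih _ (fun u hu => ?_) ?_
      · refine le_trans ?_ (hW u (mem_filter.1 hu).1)
        exact_mod_cast card_le_card (filter_subset_filter _ (filter_subset _ _))
      · have hsplit : (#{w ∈ W | G.Adj v w} : ℝ) + #{w ∈ W | ¬ G.Adj v w} = #W := by
          exact_mod_cast card_filter_add_card_filter_not (s := W) (fun w => G.Adj v w)
        push_cast at hxy
        linarith [hW v hv]
    rw [card_cliqueTuples_succ, Nat.cast_sum]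
    calc y ^ (k + 1 + 1) = y * y ^ (k + 1) := pow_succ' _ _
      _ ≤ #W * y ^ (k + 1) := by gcongr
      _ = #W • y ^ (k + 1) := (nsmul_eq_mul _ _).symm
      _ ≤ ∑ v ∈ W, (#(cliqueTuples G (k + 1) {w ∈ W | G.Adj v w}) : ℝ) :=
          card_nsmul_le_sum _ _ _ hextend

lemma exists_isNClique_mul_pow_le_card_cliqueTuples [Nonempty V] {h d k : ℕ} (hh : 0 < h)
    {p β : ℝ} (hp : 0 ≤ p) (hβ : 0 < β) (W : Finset V)
    (hW : p * (Fintype.card V : ℝ) ^ (k + 1) ≤ #(cliqueTuples G (k + 1) W))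
    (hG : ∀ U : Finset V, Fintype.card V * p ^ d - (Fintype.card V : ℝ) ^ h * β ^ d ≤ #U →
      ∃ S ⊆ U, G.IsNClique h S) :
    ∃ A ⊆ W, G.IsNClique h A ∧ ∃ W' ⊆ W, (∀ v ∈ A, ∀ w ∈ W', G.Adj v w) ∧
      β * (Fintype.card V : ℝ) ^ k ≤ #(cliqueTuples G k W') := by
  classical
  have hcard : (Fintype.card (Fin k → V) : ℝ) = (Fintype.card V : ℝ) ^ k := by
    rw [Fintype.card_fun, Fintype.card_fin, Nat.cast_pow]
  obtain ⟨U, hU, hUS⟩ := dependent_random_choice (V := V) (B := Fin k → V)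
    (fun v T => (Fin.cons v T : Fin (k + 1) → V) ∈ cliqueTuples G (k + 1) W)
    hh d hp hβ.le (by
      rw [card_cliqueTuples_succ_eq_sum_cons, Nat.cast_sum] at hW
      rw [hcard, mul_assoc, ← pow_succ']
      exact hW.trans_eq (sum_congr rfl fun v _ => by congr))
  obtain ⟨A, hAU, hA⟩ := hG U hU
  have hA0 : A.Nonempty := card_pos.1 (hA.card_eq.symm ▸ hh)
  have hT := hUS A hAU hA.card_eq
  simp only [forall_cons_mem_cliqueTuples hA0, hcard] at hT
  have hAW : A ⊆ W := by
    have hpos : (0 : ℝ) < _ := lt_of_lt_of_le (by positivity) hT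
    obtain ⟨T, hT'⟩ := card_pos.1 (Nat.cast_pos.1 hpos)
    exact (mem_filter.1 hT').2.1
  refine ⟨A, hAW, hA, {w ∈ W | ∀ v ∈ A, G.Adj v w}, filter_subset _ _,
    fun v hv w hw => (mem_filter.1 hw).2 v hv, hT.trans (Nat.cast_le.2 (card_le_card ?_))⟩
  intro T hT'
  exact (mem_filter.1 hT').2.2

end CliqueTuples

lemma isNClique_union {V : Type*} [DecidableEq V] {G : SimpleGraph V} {a b : ℕ} {A B : Finset V}
    (hA : G.IsNClique a A) (hB : G.IsNClique b B) (h : ∀ v ∈ A, ∀ w ∈ B, G.Adj v w) :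
    G.IsNClique (a + b) (A ∪ B) := by
  refine ⟨?_, ?_⟩
  · rw [coe_union, IsClique, Set.pairwise_union]
    exact ⟨hA.isClique, hB.isClique, fun v hv w hw _ => ⟨h v hv w hw, (h v hv w hw).symm⟩⟩
  · rw [card_union_of_disjoint, hA.card_eq, hB.card_eq]
    exact disjoint_left.2 fun v hvA hvB => G.irrefl (h v hvA v hvB)

lemma rpow_one_sub_le_mul_rpow_pow_sub {x δ γ : ℝ} {h d : ℕ} (hx : 1 ≤ x) (hδ1 : δ ≤ 1)
    (hd : 0 < d) (hh : h ≤ γ * d) (hx2 : 2 ≤ x ^ (δ / 2)) :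
    x ^ (1 - δ) ≤ x * (x ^ (-(δ / (2 * d)))) ^ d - x ^ h * (x ^ (-γ)) ^ d := by
  have hx0 : 0 < x := one_pos.trans_le hx
  have hmain : x * (x ^ (-(δ / (2 * d)))) ^ d = x ^ (1 - δ) * x ^ (δ / 2) := by
    nth_rw 1 [← Real.rpow_one x]
    rw [← Real.rpow_mul_natCast hx0.le, ← Real.rpow_add hx0, ← Real.rpow_add hx0]
    congr 1
    field_simp
    ring
  have hloss : x ^ h * (x ^ (-γ)) ^ d ≤ 1 := by
    rw [← Real.rpow_mul_natCast hx0.le, ← Real.rpow_natCast, ← Real.rpow_add hx0]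
    exact Real.rpow_le_one_of_one_le_of_nonpos hx (by linarith)
  have hone : 1 ≤ x ^ (1 - δ) := Real.one_le_rpow hx (by linarith)
  rw [hmain]
  nlinarith

lemma exists_isNClique_of_cliqueTuples {h : ℕ} (hh : 0 < h) {δ : ℝ} (hδ : 0 < δ) (hδ1 : δ ≤ 1)
    (k : ℕ) :
    ∃ γ : ℝ, 0 < γ ∧ ∀ᶠ n : ℕ in atTop, ∀ G : SimpleGraph (Fin n),
      (∀ U : Finset (Fin n), (n : ℝ) ^ (1 - δ) ≤ #U → ∃ S ⊆ U, G.IsNClique h S) →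
      ∀ W : Finset (Fin n), (n : ℝ) ^ (-γ) * (n : ℝ) ^ k ≤ #(cliqueTuples G k W) →
      ∃ S ⊆ W, G.IsNClique (k * h) S := by
  classical
  induction k with
  | zero =>
    refine ⟨1, one_pos, Eventually.of_forall fun n G _ W _ => ⟨∅, empty_subset _, ?_⟩⟩
    rw [zero_mul]
    exact isNClique_empty.2 rfl
  | succ k ih =>
    obtain ⟨γ, hγ, hclique⟩ := ih
    obtain ⟨d, hd⟩ := exists_nat_ge (h / γ)
    rw [div_le_iff₀' hγ] at hd
    have hd0 : 0 < d := by
      refine Nat.pos_of_ne_zero fun hd0 => ?_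
      rw [hd0, Nat.cast_zero, mul_zero] at hd
      exact hd.not_gt (by exact_mod_cast hh)
    have hlarge := ((tendsto_rpow_atTop (half_pos hδ)).comp
      tendsto_natCast_atTop_atTop).eventually_ge_atTop 2
    refine ⟨δ / (2 * d), by positivity, ?_⟩
    filter_upwards [hclique, hlarge, eventually_ge_atTop 1] with n hclique hn hn1 G hG W hW
    have : Nonempty (Fin n) := ⟨⟨0, hn1⟩⟩
    have hdense : ∀ U : Finset (Fin n),
        n * ((n : ℝ) ^ (-(δ / (2 * d)))) ^ d - (n : ℝ) ^ h * ((n : ℝ) ^ (-γ)) ^ d ≤ #U →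
        ∃ S ⊆ U, G.IsNClique h S := fun U hU =>
      hG U ((rpow_one_sub_le_mul_rpow_pow_sub (by exact_mod_cast hn1) hδ1 hd0 hd hn).trans hU)
    obtain ⟨A, hAW, hA, W', hW'W, hAW', hT⟩ :=
      exists_isNClique_mul_pow_le_card_cliqueTuples G (d := d) hh
        (p := (n : ℝ) ^ (-(δ / (2 * d)))) (β := (n : ℝ) ^ (-γ)) (by positivity) (by positivity) W
        (by rwa [Fintype.card_fin]) (by rwa [Fintype.card_fin])
    rw [Fintype.card_fin] at hT
    obtain ⟨S, hS, hSclique⟩ := hclique G hG _ hT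
    refine ⟨A ∪ S, union_subset hAW (hS.trans hW'W), ?_⟩
    rw [add_one_mul, add_comm]
    exact isNClique_union hA hSclique fun v hv w hw => hAW' v hv w (hS hw)

/-! ### Supersaturation -/

lemma card_interedges_erase {V : Type*} [DecidableEq V] (G : SimpleGraph V) [DecidableRel G.Adj]
    {W : Finset V} {v : V} (hv : v ∈ W) :
    #(G.interedges W W) =
      #(G.interedges (W.erase v) (W.erase v)) + 2 * #{w ∈ W | G.Adj v w} := by
  have card_eq_sum (X : Finset V) :
      #(G.interedges X X) = ∑ u ∈ X, ∑ w ∈ X, if G.Adj u w then 1 else 0 := by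
    rw [interedges_def, card_filter, sum_product]
  have hcol : ∑ u ∈ W.erase v, (if G.Adj u v then 1 else 0) = #{w ∈ W | G.Adj v w} := by
    simp only [G.adj_comm _ v, card_filter, ← add_sum_erase W _ hv, G.irrefl, if_false, zero_add]
  have hrow (u : V) : ∑ w ∈ W, (if G.Adj u w then 1 else 0) =
      (if G.Adj u v then 1 else 0) + ∑ w ∈ W.erase v, if G.Adj u w then 1 else 0 :=
    (add_sum_erase W _ hv).symm
  rw [card_eq_sum, card_eq_sum, ← add_sum_erase W _ hv, ← card_filter]
  simp only [hrow, sum_add_distrib, hcol]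
  ring

-- A set `W` maximizing `2 e(W) - κ |W| ^ 2` works: deleting a vertex of `W` does not increase this
-- quantity, which bounds the degrees in `W` from below.
open Classical in
lemma exists_forall_card_filter_not_adj_le {V : Type*} [Fintype V] (G : SimpleGraph V) {κ ε : ℝ}
    (hκ : 0 ≤ κ) (hE : (κ + ε) * (Fintype.card V : ℝ) ^ 2 ≤ 2 * G.edgeSet.ncard) :
    ∃ W : Finset V, ε * (Fintype.card V : ℝ) ^ 2 ≤ (#W : ℝ) ^ 2 ∧
      ∀ v ∈ W, (#{w ∈ W | ¬ G.Adj v w} : ℝ) ≤ (1 - κ) * #W + κ / 2 := by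
  have hedges : (2 * G.edgeSet.ncard : ℝ) = #(G.interedges univ univ) := by
    rw [← coe_edgeFinset, Set.ncard_coe_finset]
    exact_mod_cast G.two_mul_card_edgeFinset
  obtain ⟨W, -, hW⟩ := exists_max_image (univ : Finset (Finset V))
    (fun W => (#(G.interedges W W) : ℝ) - κ * (#W : ℝ) ^ 2) univ_nonempty
  refine ⟨W, ?_, fun v hv => ?_⟩
  · have hmax := hW univ (mem_univ _)
    have hle : (#(G.interedges W W) : ℝ) ≤ #W * #W := by
      exact_mod_cast G.card_interedges_le_mul W W
    rw [← hedges, card_univ] at hmax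
    nlinarith [mul_nonneg hκ (sq_nonneg (#W : ℝ))]
  · have hmax := hW (W.erase v) (mem_univ _)
    have herase : (#(G.interedges W W) : ℝ) =
        #(G.interedges (W.erase v) (W.erase v)) + 2 * #{w ∈ W | G.Adj v w} := by
      exact_mod_cast card_interedges_erase G hv
    have hcard : (#(W.erase v) : ℝ) = #W - 1 := by
      rw [card_erase_of_mem hv, Nat.cast_pred (card_pos.2 ⟨v, hv⟩)]
    have hsplit : (#{w ∈ W | G.Adj v w} : ℝ) + #{w ∈ W | ¬ G.Adj v w} = #W := by
      exact_mod_cast card_filter_add_card_filter_not (s := W) (fun w => G.Adj v w)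
    rw [herase, hcard] at hmax
    nlinarith

lemma pow_le_card_cliqueTuples_univ {V : Type*} [Fintype V] (G : SimpleGraph V) {r : ℕ}
    (hr : 0 < r) {ε : ℝ} (hε : 0 < ε) (hV : 1 - 1 / (r : ℝ) + ε ≤ ε * √ε * Fintype.card V)
    (hE : (1 - 1 / (r : ℝ) + 2 * ε) * (Fintype.card V : ℝ) ^ 2 ≤ 2 * G.edgeSet.ncard) :
    (ε * √ε / 2 * Fintype.card V) ^ (r + 1) ≤ #(cliqueTuples G (r + 1) univ) := by
  classical
  have hr1 : (1 : ℝ) ≤ r := by exact_mod_cast hr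
  set κ : ℝ := 1 - 1 / r + ε with hκ
  have hκ0 : 0 < κ := by
    have : 1 / (r : ℝ) ≤ 1 := (div_le_one (by positivity)).2 hr1
    linarith
  obtain ⟨W, hWcard, hW⟩ := exists_forall_card_filter_not_adj_le G (κ := κ) (ε := ε) hκ0.le
    (by linarith)
  have hsqrt : √ε * Fintype.card V ≤ #W := by
    refine le_of_sq_le_sq ?_ (by positivity)
    rwa [mul_pow, Real.sq_sqrt hε.le]
  have hεW : ε * √ε * Fintype.card V ≤ ε * #W := by
    rw [mul_assoc]
    gcongr
  obtain ⟨v, hv⟩ : W.Nonempty := by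
    rw [← card_pos, ← Nat.cast_pos (α := ℝ)]
    exact pos_of_mul_pos_right (hκ0.trans_le (hV.trans hεW)) hε.le
  have hx : 0 ≤ (1 - κ) * #W + κ / 2 := le_trans (by positivity) (hW v hv)
  have hsum : r * ((1 - κ) * #W + κ / 2) + ε * √ε / 2 * Fintype.card V ≤ #W := by
    have hx_mul : r * ((1 - κ) * #W + κ / 2) = #W - r * (ε * #W - κ / 2) := by
      rw [hκ]
      field_simp
      ring
    have : ε * #W - κ / 2 ≤ r * (ε * #W - κ / 2) := le_mul_of_one_le_left (by linarith) hr1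
    linarith
  calc (ε * √ε / 2 * Fintype.card V) ^ (r + 1)
      ≤ #(cliqueTuples G (r + 1) W) := pow_le_card_cliqueTuples G hx (by positivity) r W hW hsum
    _ ≤ #(cliqueTuples G (r + 1) univ) :=
        Nat.cast_le.2 (card_le_card (cliqueTuples_mono G _ (subset_univ W)))

lemma eventually_mul_pow_le_card_cliqueTuples {r : ℕ} (hr : 0 < r) {ε : ℝ} (hε : 0 < ε) :
    ∃ c : ℝ, 0 < c ∧ ∀ᶠ n : ℕ in atTop, ∀ G : SimpleGraph (Fin n),
      (1 / 2 * (1 - 1 / (r : ℝ)) + ε) * (n : ℝ) ^ 2 ≤ G.edgeSet.ncard →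
      c * (n : ℝ) ^ (r + 1) ≤ #(cliqueTuples G (r + 1) univ) := by
  refine ⟨(ε * √ε / 2) ^ (r + 1), by positivity, ?_⟩
  have hlarge := (tendsto_natCast_atTop_atTop.const_mul_atTop
    (by positivity : 0 < ε * √ε)).eventually_ge_atTop (1 - 1 / (r : ℝ) + ε)
  filter_upwards [hlarge] with n hn G hG
  rw [← mul_pow]
  simpa only [Fintype.card_fin] using pow_le_card_cliqueTuples_univ G hr hε
    (by rwa [Fintype.card_fin]) (by rw [Fintype.card_fin]; linarith)

/-! ### The Ramsey-Turán function -/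

lemma free_top_iff_cliqueFree {V : Type*} {G : SimpleGraph V} {s : ℕ} :
    (⊤ : SimpleGraph (Fin s)).Free G ↔ G.CliqueFree s := by
  simpa only [Fintype.card_fin] using (cliqueFree_iff_top_free (G := G) (β := Fin s)).symm

lemma ncard_edgeSet_le_rtNumber {V : Type*} {n : ℕ} {H : SimpleGraph V} {x : ℝ}
    (G : SimpleGraph (Fin n)) (hG : H.Free G) (hx : (G.indepNum : ℝ) < x) :
    G.edgeSet.ncard ≤ rtNumber n H x := by
  refine le_csSup ⟨(Set.univ : Set (Sym2 (Fin n))).ncard, ?_⟩ ⟨G, hG, hx, rfl⟩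
  rintro e ⟨G', -, -, rfl⟩
  exact Set.ncard_le_ncard (Set.subset_univ _) Set.finite_univ

lemma rtNumber_le {V : Type*} {n : ℕ} {H : SimpleGraph V} {x b : ℝ} (hb : 0 ≤ b)
    (h : ∀ G : SimpleGraph (Fin n), H.Free G → (G.indepNum : ℝ) < x →
      (G.edgeSet.ncard : ℝ) ≤ b) :
    (rtNumber n H x : ℝ) ≤ b := by
  rw [← Nat.le_floor_iff hb]
  refine csSup_le' ?_
  rintro e ⟨G, hG, hGx, rfl⟩
  exact Nat.le_floor (h G hG hGx)

lemma RamseyGap.eventually_ncard_edgeSet_lt {s t r : ℕ} (ht : 2 ≤ t) (hr : 0 < r)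
    (hs : s ≤ (r + 1) * (t - 1)) (hgap : RamseyGap t) {ε : ℝ} (hε : 0 < ε) :
    ∀ᶠ n : ℕ in atTop, ∀ G : SimpleGraph (Fin n), G.CliqueFree s →
      G.indepNum < inverseRamsey t n →
      (G.edgeSet.ncard : ℝ) < (1 / 2 * (1 - 1 / (r : ℝ)) + ε) * (n : ℝ) ^ 2 := by
  obtain ⟨δ, hδ, hδ1, hdense⟩ := hgap.eventually_exists_isNClique ht
  obtain ⟨γ, hγ, hclique⟩ :=
    exists_isNClique_of_cliqueTuples (Nat.sub_pos_of_lt ht) hδ hδ1 (r + 1)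
  obtain ⟨c, hc, htuples⟩ := eventually_mul_pow_le_card_cliqueTuples hr hε
  have hγc := ((tendsto_rpow_neg_atTop hγ).comp
    tendsto_natCast_atTop_atTop).eventually_le_const hc
  filter_upwards [hdense, hclique, htuples, hγc] with n hdense hclique htuples hγc G hGs hG
  by_contra! hlt
  obtain ⟨S, -, hS⟩ := hclique G (hdense G hG) univ
    ((mul_le_mul_of_nonneg_right hγc (by positivity)).trans (htuples G hlt))
  exact hGs.mono hs S hS

lemma RamseyGap.eventually_rtNumber_div_lt {s t r : ℕ} (ht : 2 ≤ t) (hr : 0 < r)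
    (hs : s ≤ (r + 1) * (t - 1)) (hgap : RamseyGap t) {a : ℝ}
    (ha : 1 / 2 * (1 - 1 / (r : ℝ)) < a) :
    ∀ᶠ n : ℕ in atTop,
      (rtNumber n (⊤ : SimpleGraph (Fin s)) (inverseRamsey t n : ℝ) : ℝ) / (n : ℝ) ^ 2 < a := by
  have hr1 : 1 / (r : ℝ) ≤ 1 := by simpa only [one_div] using Nat.cast_inv_le_one r
  obtain ⟨b, hb, hba⟩ := exists_between ha
  filter_upwards [hgap.eventually_ncard_edgeSet_lt ht hr hs (sub_pos.2 hb),
    eventually_gt_atTop 0] with n hn hn0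
  rw [add_sub_cancel] at hn
  have hle := rtNumber_le (H := (⊤ : SimpleGraph (Fin s))) (x := inverseRamsey t n)
    (b := b * (n : ℝ) ^ 2) (mul_nonneg (by linarith) (by positivity)) fun G hG hGx =>
      (hn G (free_top_iff_cliqueFree.1 hG) (by exact_mod_cast hGx)).le
  exact ((div_le_iff₀ (by positivity)).2 hle).trans_lt hba

/-! ### Joins of copies of a graph -/

/-- The graph obtained from disjoint copies of `G₀`, one for every element of `C`, by joining
vertices of different copies. It is the lexicographic product of the complete graph on `C` with
`G₀`, and its induced subgraphs are the extremal graphs of the lower bound. The implication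
makes vertices of different copies adjacent unconditionally. -/
def joinCopies (C : Type*) {P : Type*} (G₀ : SimpleGraph P) : SimpleGraph (C × P) where
  Adj x y := x.1 = y.1 → G₀.Adj x.2 y.2
  symm := ⟨fun _ _ h hxy => (h hxy.symm).symm⟩
  loopless := ⟨fun _ h => G₀.irrefl (h rfl)⟩

section JoinCopies

variable {C P : Type*} {G₀ : SimpleGraph P}

lemma cliqueFree_joinCopies [Fintype C] {t : ℕ} (hG₀ : G₀.CliqueFree (t + 1)) :
    (joinCopies C G₀).CliqueFree (Fintype.card C * t + 1) := by
  classical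
  intro S hS
  obtain ⟨a, -, ha⟩ := exists_lt_card_fiber_of_mul_lt_card_of_maps_to
    (s := S) (t := (univ : Finset C)) (f := Prod.fst) (n := t) (fun _ _ => mem_univ _)
    (by rw [hS.card_eq, card_univ]; exact Nat.lt_succ_self _)
  have hfib : ∀ x ∈ {x ∈ S | x.1 = a}, ∀ y ∈ {x ∈ S | x.1 = a}, x.1 = y.1 := fun x hx y hy =>
    (mem_filter.1 hx).2.trans (mem_filter.1 hy).2.symm
  refine hG₀.mono ha (image Prod.snd {x ∈ S | x.1 = a}) ⟨?_, ?_⟩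
  · rw [IsClique, coe_image]
    rintro _ ⟨x, hx, rfl⟩ _ ⟨y, hy, rfl⟩ hxy
    exact hS.isClique (mem_filter.1 hx).1 (mem_filter.1 hy).1 (ne_of_apply_ne _ hxy)
      (hfib x hx y hy)
  · exact card_image_of_injOn fun x hx y hy hxy => Prod.ext (hfib x hx y hy) hxy

lemma indepNum_joinCopies_le [Finite C] [Finite P] :
    (joinCopies C G₀).indepNum ≤ G₀.indepNum := by
  classical
  have := Fintype.ofFinite P
  have := Fintype.ofFinite C
  obtain ⟨S, hS⟩ := (joinCopies C G₀).exists_isNIndepSet_indepNum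
  have hfst : ∀ x ∈ S, ∀ y ∈ S, x.1 = y.1 := by
    intro x hx y hy
    by_contra hxy
    exact hS.isIndepSet hx hy (ne_of_apply_ne _ hxy) fun h => absurd h hxy
  rw [← hS.card_eq, ← card_image_of_injOn (f := Prod.snd) (s := S)
    fun x hx y hy hxy => Prod.ext (hfst x hx y hy) hxy]
  refine IsIndepSet.card_le_indepNum ?_
  rw [IsIndepSet, coe_image]
  rintro _ ⟨x, hx, rfl⟩ _ ⟨y, hy, rfl⟩ hxy hadj
  exact hS.isIndepSet hx hy (ne_of_apply_ne _ hxy) fun _ => hadj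

lemma card_mul_sub_le_two_mul_ncard_edgeSet_comap_joinCopies {V : Type*} [Fintype V] [Fintype P]
    (f : V ↪ C × P) :
    Fintype.card V * (Fintype.card V - Fintype.card P) ≤
      2 * ((joinCopies C G₀).comap f).edgeSet.ncard := by
  classical
  rw [← coe_edgeFinset, Set.ncard_coe_finset, ← sum_degrees_eq_twice_card_edges, ← smul_eq_mul,
    ← card_univ (α := V)]
  refine card_nsmul_le_sum _ _ _ fun v _ => ?_
  have hsame : #{w | (f w).1 = (f v).1} ≤ Fintype.card P :=
    card_le_card_of_injOn (fun w => (f w).2) (fun _ _ => mem_univ _) fun w hw w' hw' hww' =>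
      f.injective (Prod.ext ((mem_filter.1 hw).2.trans (mem_filter.1 hw').2.symm) hww')
  have hdeg : #{w | ¬ (f w).1 = (f v).1} ≤ ((joinCopies C G₀).comap f).degree v := by
    rw [← card_neighborFinset_eq_degree]
    refine card_le_card fun w hw => ?_
    rw [mem_neighborFinset]
    exact fun h => absurd h.symm (mem_filter.1 hw).2
  have hsplit := card_filter_add_card_filter_not (s := (univ : Finset V))
    fun w => (f w).1 = (f v).1
  omega

end JoinCopies

lemma indepNum_comap_le {V W : Type*} [Finite V] [Finite W] (G : SimpleGraph W) (f : V ↪ W) :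
    (G.comap f).indepNum ≤ G.indepNum := by
  have := Fintype.ofFinite V
  have := Fintype.ofFinite W
  obtain ⟨S, hS⟩ := (G.comap f).exists_isNIndepSet_indepNum
  have hS' := isNIndepSet_map_of_comap hS
  exact hS'.card_eq ▸ hS'.isIndepSet.card_le_indepNum

lemma mul_sub_le_two_mul_rtNumber {s t r m n : ℕ} (ht : 2 ≤ t) (hs : r * (t - 1) < s)
    (hn : n ≤ r * m) {x : ℝ} (hx : (inverseRamsey t m : ℝ) < x) :
    n * (n - m) ≤ 2 * rtNumber n (⊤ : SimpleGraph (Fin s)) x := by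
  obtain ⟨G₀, hG₀, hG₀t⟩ := exists_cliqueFree_indepNum_eq_inverseRamsey ht m
  obtain ⟨f⟩ : Nonempty (Fin n ↪ Fin r × Fin m) :=
    Function.Embedding.nonempty_of_card_le (by simpa using hn)
  have hfree : ((joinCopies (Fin r) G₀).comap f).CliqueFree s := by
    have h := cliqueFree_joinCopies (C := Fin r) (t := t - 1) (G₀ := G₀)
      (by rwa [Nat.sub_add_cancel (one_le_two.trans ht)])
    rw [Fintype.card_fin] at h
    exact (h.comap ⟨(Embedding.comap f _).toCopy⟩).mono hs
  have hindep : (((joinCopies (Fin r) G₀).comap f).indepNum : ℝ) < x := by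
    refine lt_of_le_of_lt ?_ hx
    exact_mod_cast hG₀t ▸ (indepNum_comap_le _ f).trans indepNum_joinCopies_le
  have hedges := card_mul_sub_le_two_mul_ncard_edgeSet_comap_joinCopies (G₀ := G₀) f
  rw [Fintype.card_fin, Fintype.card_fin] at hedges
  exact hedges.trans
    (Nat.mul_le_mul_left 2 (ncard_edgeSet_le_rtNumber _ (free_top_iff_cliqueFree.2 hfree) hindep))

lemma RamseyGap.eventually_lt_rtNumber_div {s t r : ℕ} (ht : 2 ≤ t) (hr : 2 ≤ r)
    (hs : r * (t - 1) < s) (hgap : RamseyGap t) {a : ℝ}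
    (ha : a < 1 / 2 * (1 - 1 / (r : ℝ))) :
    ∀ᶠ n : ℕ in atTop,
      a < (rtNumber n (⊤ : SimpleGraph (Fin s)) (inverseRamsey t n : ℝ) : ℝ) / (n : ℝ) ^ 2 := by
  have hlarge := (tendsto_natCast_atTop_atTop.const_mul_atTop
    (sub_pos.2 ha)).eventually_gt_atTop 1
  filter_upwards [hgap.eventually_inverseRamsey_div_add_one_lt ht hr, hlarge,
    eventually_gt_atTop 0] with n hQ hn hn0
  have hrt : n * (n - (n / r + 1)) ≤
      2 * rtNumber n (⊤ : SimpleGraph (Fin s)) (inverseRamsey t n : ℝ) :=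
    mul_sub_le_two_mul_rtNumber ht hs (Nat.lt_mul_div_succ n (by omega)).le
      (by exact_mod_cast hQ)
  have hsub : (n : ℝ) - (n / r + 1) ≤ (n - (n / r + 1) : ℕ) :=
    calc (n : ℝ) - (n / r + 1) ≤ n - ((n / r : ℕ) + 1) := by
          gcongr
          exact Nat.cast_div_le
      _ = (n : ℝ) - (n / r + 1 : ℕ) := by push_cast; rfl
      _ ≤ (n - (n / r + 1) : ℕ) := sub_le_iff_le_add.2 (by exact_mod_cast le_tsub_add)
  have hlow : (n : ℝ) * (n - (n / r + 1)) ≤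
      2 * rtNumber n (⊤ : SimpleGraph (Fin s)) (inverseRamsey t n : ℝ) :=
    (mul_le_mul_of_nonneg_left hsub n.cast_nonneg).trans (by exact_mod_cast hrt)
  rw [lt_div_iff₀ (by positivity)]
  have : (n : ℝ) * (n - (n / r + 1)) = (1 - 1 / (r : ℝ)) * (n : ℝ) ^ 2 - n := by ring
  nlinarith [(Nat.cast_pos (α := ℝ)).2 hn0]

lemma RamseyGap.tendsto_rtNumber_div {s t r : ℕ} (ht : 2 ≤ t) (hr : 0 < r)
    (hs : s ≤ (r + 1) * (t - 1)) (hs' : r * (t - 1) < s) (hgap : RamseyGap t) :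
    Tendsto (fun n : ℕ => (rtNumber n (⊤ : SimpleGraph (Fin s)) (inverseRamsey t n : ℝ) : ℝ) /
      (n : ℝ) ^ 2) atTop (nhds (1 / 2 * (1 - 1 / (r : ℝ)))) := by
  refine tendsto_order.2 ⟨fun a ha => ?_, fun a ha => hgap.eventually_rtNumber_div_lt ht hr hs ha⟩
  obtain rfl | hr2 := (Nat.succ_le_of_lt hr).eq_or_lt
  · refine Eventually.of_forall fun n => ha.trans_le ?_
    rw [Nat.succ_eq_add_one, zero_add, Nat.cast_one, div_one, sub_self, mul_zero]
    positivity
  · exact hgap.eventually_lt_rtNumber_div ht hr2 hs' ha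

end RamseyTuran

theorem mainTheorem9 (s t r : ℕ) (ht : 2 ≤ t) (hts : t ≤ s) (hr : r = (s - 1) / (t - 1))
    (hgap : RamseyTuran.RamseyGap t) :
    RamseyTuran.HasRTDensity (⊤ : SimpleGraph (Fin s))
      (fun n : ℕ => (RamseyTuran.inverseRamsey t n : ℝ)) (1 / 2 * (1 - 1 / (r : ℝ))) := by
  have ht0 : 0 < t - 1 := Nat.sub_pos_of_lt ht
  have hr0 : 0 < r := hr ▸ Nat.div_pos (by omega) ht0
  have hupper : s - 1 < (t - 1) * (r + 1) := hr ▸ Nat.lt_mul_div_succ (s - 1) ht0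
  have hlower : r * (t - 1) ≤ s - 1 := hr ▸ Nat.div_mul_le_self (s - 1) (t - 1)
  have h := hgap.tendsto_rtNumber_div (s := s) (r := r) ht hr0 (by rw [mul_comm]; omega) (by omega)
  exact ⟨h.limsup_eq, h.liminf_eq⟩
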